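/- Let $0<p<1$ be fixed and set $b=1/(1-p)$. For a positive integer $c$, let $G(n,p,c)$ be the randomly vertex-coloured random graph on $n$ vertices in which each of the $\binom n2$ possible edges is present independently with probability $p$, and each vertex receives one of the colours $1,\dots,c$ uniformly at random, all colours being chosen independently of each other and of the edges. A set $S$ of vertices is a tropical dominating set if every vertex either belongs to $S$ or has a neighbour in $S$, and each of the $c$ colours appears on at least one vertex of $S$. Let $$c(n)=\big\lfloor \log_b n-\log_b\big[(\log_b n)(\log n)\big]\big\rfloor+2,$$ where $\log$ denotes the natural logarithm; $c(n)$ is a positive integer for all sufficiently large $n$. Then, with $c=c(n)$, the probability that $G(n,p,c)$ contains a tropical dominating set of size exactly $c$ tends to $1$ as $n\to\infty$. -/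

import Mathlib

open MeasureTheory ProbabilityTheory Filter Topology

namespace TropicalDomination

/-- `S` is a dominating set of `G`: every vertex is in `S` or has a neighbour in `S`. -/
def IsDominating {V : Type*} (G : SimpleGraph V) (S : Finset V) : Prop :=
  ∀ v, v ∈ S ∨ ∃ u ∈ S, G.Adj v u

/-- `S` is a tropical dominating set of the graph `G` with vertex colouring `col`:
it is dominating, and every colour of the palette `C` appears on a vertex of `S`.
The colouring need not be proper. -/
def IsTropicalDominating {V C : Type*} (G : SimpleGraph V) (col : V → C) (S : Finset V) : Prop :=
  IsDominating G S ∧ ∀ i : C, ∃ v ∈ S, col v = i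

/-- The law of a colouring of `n` vertices in which each vertex receives, independently,
a uniformly random one of `c` colours (a probability measure when `0 < c`). -/
noncomputable def randomColouring (n c : ℕ) : Measure (Fin n → Fin c) :=
  Measure.pi fun _ => uniformOn Set.univ

/-- The law of the randomly vertex-coloured random graph `G(n, p, c)`: the pair of a binomial
random graph `G(n, p)` and an independent uniformly random vertex colouring with `c` colours. -/
noncomputable def colouredRandomGraph (n : ℕ) (p : unitInterval) (c : ℕ) :
    Measure (SimpleGraph (Fin n) × (Fin n → Fin c)) :=
  (SimpleGraph.binomialRandom (Fin n) p).prod (randomColouring n c)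

/-- `⌊log_b n - log_b ((log_b n) (log n))⌋ + 2`, where `log` is the natural logarithm.
This integer is positive for all large `n` when `1 < b`, so that truncating it at `0`
concerns finitely many `n` only. -/
noncomputable def numColours (b : ℝ) (n : ℕ) : ℕ :=
  (⌊Real.logb b n - Real.logb b (Real.logb b n * Real.log n)⌋ + 2).toNat

end TropicalDomination

namespace TropicalDomination

/-! Write `q = 1 - p = b⁻¹`, let `r` be the number of colours and `x = q ^ r`. Fix `r` disjoint
blocks of `m = ⌊n / r⌋` vertices. For each transversal of the blocks, consider the event that it
dominates and that its vertex in block `i` has colour `i`; any such event yields the required set.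
Prescribing colours by block keeps the events for two transversals compatible.

If two transversals agree in `k` blocks, their events have correlation at most `(1 - x) ^ (-2r) * (r
* w) ^ k` with `w = exp (n * x / ((1 - x) ^ 2 * r))` (`both_dominate_bound`). The sum over all pairs
factorises over the blocks (`sum_sum_prod_ite_eq`), so the second moment method gives the finite
bound `exists_tropical_lower_bound`, which tends to `1` once `r * x` and `r ^ 2 * w / m` tend to
`0`.

For `r = numColours b n`, `n * x ≤ b⁻¹ * log_b n * log n` and `r ~ log_b n`. Hence `w ≤ n ^ θ` for
any fixed `θ` in `(b⁻¹, 1)` and large `n`, which beats `m ≥ n / (2r)` up to powers of `log n`. -/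

/-! ### A second moment bound -/

/-- The second moment method: if the events `A i` satisfy `a ≤ μ (A i)` and
`μ (A i ∩ A j) ≤ a ^ 2 * ρ i j`, then their union has probability at least
`(card ι) ^ 2 / ∑ i, ∑ j, ρ i j`. -/
lemma card_sq_div_sum_le_measureReal_iUnion {Ω ι : Type*} [MeasurableSpace Ω] [Fintype ι]
    [Nonempty ι] (μ : Measure Ω) [IsProbabilityMeasure μ] {A : ι → Set Ω}
    (hA : ∀ i, MeasurableSet (A i)) {a : ℝ} (ha : 0 < a) {ρ : ι → ι → ℝ}
    (h₁ : ∀ i, a ≤ μ.real (A i)) (h₂ : ∀ i j, μ.real (A i ∩ A j) ≤ a ^ 2 * ρ i j) :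
    (Fintype.card ι : ℝ) ^ 2 / ∑ i, ∑ j, ρ i j ≤ μ.real (⋃ i, A i) := by
  classical
  set U := ⋃ i, A i with hU
  have hUm : MeasurableSet U := MeasurableSet.iUnion hA
  set I : Set Ω → Ω → ℝ := fun s => s.indicator 1 with hI
  have hI_integrable : ∀ s, MeasurableSet s → Integrable (I s) μ := fun s hs =>
    (integrable_const (1 : ℝ)).indicator hs
  have hintegral : ∀ s, MeasurableSet s → ∫ ω, I s ω ∂μ = μ.real s := fun s hs => by
    simp [hI, integral_indicator_one hs]
  set E₁ := ∑ i, μ.real (A i) with hE₁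
  set E₂ := ∑ i, ∑ j, μ.real (A i ∩ A j) with hE₂
  -- Expectation of `(1_U - l * ∑ 1_{A i}) ^ 2`; the factor `1_U` is absorbed because each `A i`
  -- lies in `U`.
  have key : ∀ l : ℝ, 0 ≤ μ.real U - 2 * l * E₁ + l ^ 2 * E₂ := by
    intro l
    have hpt : ∀ ω, (I U ω - l * ∑ i, I (A i) ω) ^ 2
        = I U ω - 2 * l * (∑ i, I (A i) ω) + l ^ 2 * ∑ i, ∑ j, I (A i ∩ A j) ω := by
      intro ω
      have e1 : I U ω * I U ω = I U ω := by
        by_cases h : ω ∈ U <;> simp [hI, h]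
      have e2 : I U ω * (∑ i, I (A i) ω) = ∑ i, I (A i) ω := by
        rw [Finset.mul_sum]
        refine Finset.sum_congr rfl fun i _ => ?_
        by_cases h : ω ∈ A i
        · have : ω ∈ U := Set.mem_iUnion.2 ⟨i, h⟩
          simp [hI, h, this]
        · simp [hI, h]
      have e3 : (∑ i, I (A i) ω) * (∑ i, I (A i) ω) = ∑ i, ∑ j, I (A i ∩ A j) ω := by
        rw [Finset.sum_mul_sum]
        refine Finset.sum_congr rfl fun i _ => Finset.sum_congr rfl fun j _ => ?_
        by_cases h : ω ∈ A i <;> by_cases h' : ω ∈ A j <;> simp [hI, h, h']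
      rw [← e3]
      linear_combination e1 - 2 * l * e2
    have h0 : 0 ≤ ∫ ω, (I U ω - l * ∑ i, I (A i) ω) ^ 2 ∂μ :=
      integral_nonneg fun ω => sq_nonneg _
    have i1 : Integrable (fun ω => ∑ i, I (A i) ω) μ :=
      integrable_finsetSum _ fun i _ => hI_integrable _ (hA i)
    have i2 : Integrable (fun ω => ∑ i, ∑ j, I (A i ∩ A j) ω) μ :=
      integrable_finsetSum _ fun i _ => integrable_finsetSum _ fun j _ =>
        hI_integrable _ ((hA i).inter (hA j))
    simp_rw [hpt] at h0
    have i3 : Integrable (fun ω => I U ω - 2 * l * ∑ i, I (A i) ω) μ :=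
      (hI_integrable U hUm).sub (i1.const_mul _)
    rw [integral_add i3 (i2.const_mul _),
      integral_sub (hI_integrable U hUm) (i1.const_mul _), integral_const_mul, integral_const_mul,
      integral_finsetSum _ (fun i _ => hI_integrable _ (hA i)),
      integral_finsetSum _ (fun i _ => integrable_finsetSum _ fun j _ =>
        hI_integrable _ ((hA i).inter (hA j))), hintegral U hUm] at h0
    have s1 : ∑ i, ∫ ω, I (A i) ω ∂μ = E₁ :=
      Finset.sum_congr rfl fun i _ => hintegral _ (hA i)
    have s2 : ∑ i, ∫ ω, ∑ j, I (A i ∩ A j) ω ∂μ = E₂ := by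
      refine Finset.sum_congr rfl fun i _ => ?_
      rw [integral_finsetSum _ (fun j _ => hI_integrable _ ((hA i).inter (hA j)))]
      exact Finset.sum_congr rfl fun j _ => hintegral _ ((hA i).inter (hA j))
    rwa [s1, s2] at h0
  set N : ℝ := (Fintype.card ι : ℝ) with hN
  have hNpos : 0 < N := by simp [hN, Fintype.card_pos]
  have hE₁N : N * a ≤ E₁ := by
    simpa [hE₁, hN] using Finset.sum_le_sum fun i (_ : i ∈ Finset.univ) => h₁ i
  set R := ∑ i, ∑ j, ρ i j with hR
  have hE₂R : E₂ ≤ a ^ 2 * R := by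
    rw [hR, Finset.mul_sum]
    simp_rw [Finset.mul_sum]
    exact Finset.sum_le_sum fun i _ => Finset.sum_le_sum fun j _ => h₂ i j
  have hE₁pos : 0 < E₁ := lt_of_lt_of_le (by positivity) hE₁N
  have hE₂pos : 0 < E₂ := by
    have hE₂0 : 0 ≤ E₂ := by positivity
    rcases hE₂0.lt_or_eq with h | h
    · exact h
    -- If `E₂ = 0`, this choice of `l` would force `μ U ≥ 2`.
    · have hk := key (1 / E₁)
      have hU1 : μ.real U ≤ 1 := measureReal_le_one
      rw [← h] at hk
      have : 2 * (1 / E₁) * E₁ = 2 := by field_simp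
      linarith
  have hRpos : 0 < R := by
    have : 0 < a ^ 2 * R := hE₂pos.trans_le hE₂R
    exact (pos_iff_pos_of_mul_pos this).1 (by positivity)
  have hmain : E₁ ^ 2 / E₂ ≤ μ.real U := by
    -- The minimiser of the quadratic in `l`.
    have hk := key (E₁ / E₂)
    have : μ.real U - 2 * (E₁ / E₂) * E₁ + (E₁ / E₂) ^ 2 * E₂ = μ.real U - E₁ ^ 2 / E₂ := by
      field_simp; ring
    linarith
  refine le_trans ?_ hmain
  calc N ^ 2 / R = (N * a) ^ 2 / (a ^ 2 * R) := by field_simp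
    _ ≤ E₁ ^ 2 / E₂ := by gcongr

/-! ### Domination in the binomial random graph -/

/-- A graph is determined by its adjacency relation. For finite `V` this makes every set of graphs
measurable. -/
instance {V : Type*} [Countable V] : MeasurableSingletonClass (SimpleGraph V) where
  measurableSet_singleton G := by
    have : ({G} : Set (SimpleGraph V)) = SimpleGraph.Adj ⁻¹' {G.Adj} := by
      ext H
      rw [Set.mem_preimage, Set.mem_singleton_iff, Set.mem_singleton_iff, SimpleGraph.adj_inj]
    rw [this]
    exact SimpleGraph.measurable_adj (measurableSet_singleton _)

/-- The Bernoulli law on `Prop`. -/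
noncomputable def bernoulliProp (p : unitInterval) : Measure Prop :=
  unitInterval.toNNReal p • Measure.dirac True +
    unitInterval.toNNReal (unitInterval.symm p) • Measure.dirac False

instance (p : unitInterval) : IsProbabilityMeasure (bernoulliProp p) := by
  unfold bernoulliProp
  infer_instance

lemma bernoulliProp_real_not (p : unitInterval) :
    (bernoulliProp p).real {x | ¬ x} = 1 - p := by
  simp [bernoulliProp, measureReal_def]

/-- The adjacencies of a binomial random graph between two disjoint sets of vertices are
independent Bernoulli variables. -/
lemma map_adj_binomialRandom {V : Type*} [Finite V] (p : unitInterval) {W U : Finset V}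
    (h : Disjoint W U) :
    (SimpleGraph.binomialRandom V p).map (fun G (v : W) (u : U) => G.Adj v u) =
      Measure.infinitePi fun _ : W => Measure.infinitePi fun _ : U => bernoulliProp p := by
  have hne : ∀ (v : W) (u : U), (v : V) ≠ u := fun v u e =>
    Finset.disjoint_left.1 h v.2 (e ▸ u.2)
  -- Disjointness rules out the swapped case, so distinct cross pairs are distinct edges, hence
  -- independent.
  have hinj : Function.Injective fun x : W × U => s((x.1 : V), (x.2 : V)) := by
    rintro ⟨v, u⟩ ⟨v', u'⟩ e
    have e' : s((v : V), (u : V)) = s((v' : V), (u' : V)) := e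
    rw [Sym2.eq_iff] at e'
    rcases e' with ⟨h1, h2⟩ | ⟨h1, h2⟩
    · exact Prod.ext (Subtype.ext h1) (Subtype.ext h2)
    · exact absurd h1 (hne v u')
  rw [SimpleGraph.binomialRandom_eq_map, setBernoulli_eq_map,
    Measure.map_map .of_discrete (by fun_prop), Measure.map_map .of_discrete (by fun_prop)]
  have hcomp : ((fun (G : SimpleGraph V) (v : W) (u : U) => G.Adj v u) ∘
      SimpleGraph.fromEdgeSet) ∘ (fun x : Sym2 V → Prop => {i | x i}) =
      MeasurableEquiv.curry W U Prop ∘ fun x (i : W × U) => x s((i.1 : V), (i.2 : V)) := by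
    ext x v u
    simp [hne v u]
  rw [hcomp, ← Measure.map_map (by fun_prop) (by fun_prop),
    Measure.map_infinitePi_infinitePi_of_inj hinj,
    ← Measure.infinitePi_map_curry fun (_ : W) (_ : U) => bernoulliProp p]
  congr 2
  ext1 x
  simp [bernoulliProp, hne]

lemma infinitePi_bernoulliProp_real_forall_not {κ : Type*} (p : unitInterval) (S : Finset κ) :
    (Measure.infinitePi fun _ : κ => bernoulliProp p).real {x | ∀ u ∈ S, ¬ x u} =
      (1 - p : ℝ) ^ S.card := by
  have : {x : κ → Prop | ∀ u ∈ S, ¬ x u} = Set.pi S fun _ => {y | ¬ y} := rfl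
  rw [this, measureReal_def, Measure.infinitePi_pi _ (fun _ _ => .of_discrete),
    ENNReal.toReal_prod]
  simp [← measureReal_def, bernoulliProp_real_not]

/-- Inclusion–exclusion on the complementary events. -/
lemma infinitePi_bernoulliProp_real_exists_and_exists {κ : Type*} [Finite κ] [DecidableEq κ]
    (p : unitInterval) (S T : Finset κ) :
    (Measure.infinitePi fun _ : κ => bernoulliProp p).real
        {x | (∃ u ∈ S, x u) ∧ ∃ u ∈ T, x u} =
      1 - (1 - p : ℝ) ^ S.card - (1 - p : ℝ) ^ T.card + (1 - p : ℝ) ^ (S ∪ T).card := by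
  set μ := Measure.infinitePi fun _ : κ => bernoulliProp p
  have hc : {x : κ → Prop | (∃ u ∈ S, x u) ∧ ∃ u ∈ T, x u} =
      ({x | ∀ u ∈ S, ¬ x u} ∪ {x | ∀ u ∈ T, ¬ x u})ᶜ := by
    ext x
    simp
  have hi : {x : κ → Prop | ∀ u ∈ S, ¬ x u} ∩ {x | ∀ u ∈ T, ¬ x u} =
      {x | ∀ u ∈ S ∪ T, ¬ x u} := by
    ext x
    simp only [Set.mem_inter_iff, Set.mem_ofPred_eq, Finset.mem_union]
    grind
  have hu := measureReal_union_add_inter (μ := μ) (s := {x : κ → Prop | ∀ u ∈ S, ¬ x u})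
    (t := {x | ∀ u ∈ T, ¬ x u}) (Set.toFinite _).measurableSet
  rw [hi, infinitePi_bernoulliProp_real_forall_not, infinitePi_bernoulliProp_real_forall_not,
    infinitePi_bernoulliProp_real_forall_not] at hu
  rw [hc, measureReal_compl (Set.toFinite _).measurableSet, probReal_univ]
  linarith

/-- The probability that every vertex outside `S ∪ T` has a neighbour in `S` and one in `T`. -/
lemma binomialRandom_real_dominate_outside {V : Type*} [Fintype V] [DecidableEq V]
    (p : unitInterval) (S T : Finset V) :
    (SimpleGraph.binomialRandom V p).real
        {G | ∀ v ∉ S ∪ T, (∃ u ∈ S, G.Adj v u) ∧ ∃ u ∈ T, G.Adj v u} =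
      (1 - (1 - p : ℝ) ^ S.card - (1 - p : ℝ) ^ T.card + (1 - p : ℝ) ^ (S ∪ T).card) ^
        (Fintype.card V - (S ∪ T).card) := by
  set U := S ∪ T with hU
  have hSU : S ⊆ U := Finset.subset_union_left
  have hTU : T ⊆ U := Finset.subset_union_right
  set S' : Finset U := S.subtype (· ∈ U) with hS'
  set T' : Finset U := T.subtype (· ∈ U) with hT'
  set R : Set (U → Prop) := {x | (∃ u ∈ S', x u) ∧ ∃ u ∈ T', x u} with hR
  -- The event is a product over the outside vertices, each constraining only its own row of edges
  -- into `U`.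
  have hpre : {G : SimpleGraph V | ∀ v ∉ U, (∃ u ∈ S, G.Adj v u) ∧ ∃ u ∈ T, G.Adj v u} =
      (fun G (v : ↥Uᶜ) (u : U) => G.Adj v u) ⁻¹' Set.pi (Finset.univ : Finset ↥Uᶜ) fun _ => R := by
    ext G
    simp only [Set.mem_ofPred_eq, Set.mem_preimage, Set.mem_pi, Finset.coe_univ, Set.mem_univ,
      forall_true_left, hR, hS', hT', Finset.mem_subtype, Subtype.exists, Subtype.forall,
      Finset.mem_compl]
    grind
  have hcard : ∀ A ⊆ U, (A.subtype (· ∈ U)).card = A.card := fun A hA => by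
    rw [Finset.card_subtype, Finset.filter_true_of_mem fun x hx => hA hx]
  have hunion : S' ∪ T' = U.subtype (· ∈ U) := by
    ext x
    simpa [hS', hT'] using Finset.mem_union.1 (hU ▸ x.2)
  have hmap := map_adj_binomialRandom (V := V) p (W := Uᶜ) (U := U) disjoint_compl_left
  rw [hpre, measureReal_def, ← Measure.map_apply .of_discrete (Set.toFinite _).measurableSet, hmap,
    Measure.infinitePi_pi _ (fun _ _ => (Set.toFinite _).measurableSet), ENNReal.toReal_prod]
  simp_rw [← measureReal_def, hR]
  rw [infinitePi_bernoulliProp_real_exists_and_exists, hunion, hcard S hSU, hcard T hTU,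
    hcard U subset_rfl, Finset.prod_const, Finset.card_univ, Fintype.card_coe, Finset.card_compl]

lemma binomialRandom_real_isDominating {V : Type*} [Fintype V] (p : unitInterval) (S : Finset V) :
    (SimpleGraph.binomialRandom V p).real {G | IsDominating G S} =
      (1 - (1 - p : ℝ) ^ S.card) ^ (Fintype.card V - S.card) := by
  classical
  have h := binomialRandom_real_dominate_outside p S S
  rw [Finset.union_self] at h
  have hS : {G | IsDominating G S} =
      {G | ∀ v ∉ S, (∃ u ∈ S, G.Adj v u) ∧ ∃ u ∈ S, G.Adj v u} := by
    ext G
    simp only [IsDominating, Set.mem_ofPred_eq, and_self]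
    grind
  rw [hS, h]
  ring

/-- Domination of vertices inside `S ∪ T` is discarded; this later costs only a factor `(1 - x) ^
(-2r)`. -/
lemma binomialRandom_real_isDominating_inter_le {V : Type*} [Fintype V] [DecidableEq V]
    (p : unitInterval) (S T : Finset V) :
    (SimpleGraph.binomialRandom V p).real ({G | IsDominating G S} ∩ {G | IsDominating G T}) ≤
      (1 - (1 - p : ℝ) ^ S.card - (1 - p : ℝ) ^ T.card + (1 - p : ℝ) ^ (S ∪ T).card) ^
        (Fintype.card V - (S ∪ T).card) := by
  rw [← binomialRandom_real_dominate_outside]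
  refine measureReal_mono ?_
  rintro G ⟨hS, hT⟩ v hv
  rw [Finset.mem_union, not_or] at hv
  exact ⟨(hS v).resolve_left hv.1, (hT v).resolve_left hv.2⟩

/-! ### Random colourings -/

instance (n c : ℕ) [NeZero c] : IsProbabilityMeasure (randomColouring n c) := by
  have : IsProbabilityMeasure (uniformOn (Set.univ : Set (Fin c))) :=
    isProbabilityMeasure_uniformOn Set.finite_univ Set.univ_nonempty
  unfold randomColouring
  infer_instance

/-- The probability that a random colouring takes prescribed values on a set of vertices. -/
lemma randomColouring_real_eqOn (n c : ℕ) [NeZero c] (U : Finset (Fin n)) (g : Fin n → Fin c) :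
    (randomColouring n c).real {col | ∀ v ∈ U, col v = g v} = (c : ℝ)⁻¹ ^ U.card := by
  have : IsProbabilityMeasure (uniformOn (Set.univ : Set (Fin c))) :=
    isProbabilityMeasure_uniformOn Set.finite_univ Set.univ_nonempty
  have hpi : {col : Fin n → Fin c | ∀ v ∈ U, col v = g v} =
      Set.pi Set.univ fun v => if v ∈ U then {g v} else Set.univ := by
    ext col
    simp only [Set.mem_ofPred_eq, Set.mem_pi, Set.mem_univ, forall_true_left]
    refine forall_congr' fun v => ?_
    split_ifs with h <;> simp [h]
  rw [hpi, randomColouring, measureReal_def, Measure.pi_pi, ENNReal.toReal_prod]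
  have hterm : ∀ v, (uniformOn (Set.univ : Set (Fin c))
      (if v ∈ U then {g v} else Set.univ)).toReal = if v ∈ U then (c : ℝ)⁻¹ else 1 := by
    intro v
    split_ifs
    · rw [uniformOn_univ]
      simp
    · simp
  simp_rw [hterm]
  rw [Finset.prod_ite_mem, Finset.univ_inter, Finset.prod_const]

/-! ### Transversals of a family of disjoint blocks -/

/-- The vertex set selected by `s` from the blocks `e (i, ·)`, one vertex from each block. -/
def transversal {n r m : ℕ} (e : Fin r × Fin m ↪ Fin n) (s : Fin r → Fin m) : Finset (Fin n) :=
  Finset.univ.image fun i => e (i, s i)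

variable {n r m : ℕ} (e : Fin r × Fin m ↪ Fin n) (s t : Fin r → Fin m)

lemma mem_transversal {v : Fin n} : v ∈ transversal e s ↔ ∃ i, e (i, s i) = v := by
  simp [transversal]

lemma card_transversal : (transversal e s).card = r := by
  rw [transversal, Finset.card_image_of_injective, Finset.card_univ, Fintype.card_fin]
  intro i j h
  exact congrArg Prod.fst (e.injective h)

/-- As the blocks are disjoint, a common vertex comes from the same block and the same choice in
both transversals. -/
lemma card_transversal_union :
    (transversal e s ∪ transversal e t).card =
      2 * r - (Finset.univ.filter fun i => s i = t i).card := by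
  have hinter : transversal e s ∩ transversal e t =
      (Finset.univ.filter fun i => s i = t i).image fun i => e (i, s i) := by
    ext v
    simp only [Finset.mem_inter, mem_transversal, Finset.mem_image, Finset.mem_filter,
      Finset.mem_univ, true_and]
    constructor
    · rintro ⟨⟨i, rfl⟩, j, hj⟩
      obtain ⟨rfl, h⟩ := Prod.mk.inj (e.injective hj)
      exact ⟨j, h.symm, rfl⟩
    · rintro ⟨i, h, rfl⟩
      exact ⟨⟨i, rfl⟩, i, by rw [h]⟩
  have hcard : (transversal e s ∩ transversal e t).card =
      (Finset.univ.filter fun i => s i = t i).card := by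
    rw [hinter, Finset.card_image_of_injective]
    intro i j h
    exact congrArg Prod.fst (e.injective h)
  have h := Finset.card_union_add_card_inter (transversal e s) (transversal e t)
  rw [hcard, card_transversal, card_transversal] at h
  omega

/-- For fixed `s` the sum over `t` factorises: in each block one choice agrees, with weight `y`, and
`m - 1` disagree. -/
lemma sum_sum_prod_ite_eq (y : ℝ) :
    ∑ s : Fin r → Fin m, ∑ t : Fin r → Fin m, ∏ i, (if s i = t i then y else 1) =
      (m : ℝ) ^ r * (m - 1 + y) ^ r := by
  have hinner : ∀ s : Fin r → Fin m,
      ∑ t : Fin r → Fin m, ∏ i, (if s i = t i then y else 1) = ((m : ℝ) - 1 + y) ^ r := by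
    intro s
    have h := Finset.prod_univ_sum (fun _ : Fin r => (Finset.univ : Finset (Fin m)))
      (fun i b => if s i = b then y else 1)
    rw [Fintype.piFinset_univ] at h
    rw [← h]
    have hsum : ∀ i, ∑ b : Fin m, (if s i = b then y else 1) = (m : ℝ) - 1 + y := by
      intro i
      have : ∀ b : Fin m, (if s i = b then y else 1) = (if s i = b then y - 1 else 0) + 1 := by
        intro b; split_ifs <;> ring
      simp_rw [this]
      rw [Finset.sum_add_distrib, Finset.sum_ite_eq]
      simp
      ring
    simp [hsum]
  simp [hinner]

/-! ### Pair correlations and the finite lower bound -/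

/-- The correlation between two dominating sets of size `r` with `k` common elements. -/
lemma both_dominate_bound {q : ℝ} (hq0 : 0 < q) (hq1 : q < 1) {k : ℕ} (hr : 0 < r) (hk : k ≤ r)
    (hn : 2 * r - k ≤ n) :
    (1 - q ^ r - q ^ r + q ^ (2 * r - k)) ^ (n - (2 * r - k)) ≤
      ((1 - q ^ r) ^ (n - r)) ^ 2 *
        (((1 - q ^ r) ^ (2 * r))⁻¹ * Real.exp (n * q ^ r / ((1 - q ^ r) ^ 2 * r)) ^ k) := by
  have hx0 : 0 < q ^ r := by positivity
  have hx1 : q ^ r < 1 := pow_lt_one₀ hq0.le hq1 hr.ne'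
  have hr' : (0 : ℝ) < r := by exact_mod_cast hr
  -- Convexity of `k ↦ q ^ (r - k)` between `0` and `r`. A bound linear in `k` makes the final
  -- estimate a `k`-th power, as the factorisation over blocks requires.
  have hconc : q ^ (r - k) ≤ q ^ r + k / r := by
    have h := Real.geom_mean_le_arith_mean2_weighted (w₁ := ((r - k : ℕ) : ℝ) / r) (w₂ := k / r)
      (p₁ := q ^ r) (p₂ := 1) (by positivity) (by positivity) hx0.le zero_le_one
      (by rw [← add_div, ← Nat.cast_add, Nat.sub_add_cancel hk, div_self hr'.ne'])
    rw [Real.one_rpow, mul_one, ← Real.rpow_natCast q r, ← Real.rpow_mul hq0.le,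
      mul_div_cancel₀ _ hr'.ne', Real.rpow_natCast, Real.rpow_natCast, mul_one] at h
    refine h.trans (add_le_add_left ?_ _)
    refine mul_le_of_le_one_left hx0.le ((div_le_one hr').2 ?_)
    exact_mod_cast Nat.sub_le r k
  have hpow : q ^ (2 * r - k) ≤ (q ^ r) ^ 2 + q ^ r * (k / r) := by
    have : 2 * r - k = r + (r - k) := by omega
    rw [this, pow_add]
    nlinarith
  set x := q ^ r
  set N := n - (2 * r - k) with hN
  have hy : 0 < 1 - x := by linarith
  set δ : ℝ := x * (k / r) / (1 - x) ^ 2 with hδ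
  have hδ0 : 0 ≤ δ := by positivity
  have hbase0 : 0 ≤ 1 - x - x + q ^ (2 * r - k) := by
    have : q ^ (2 * r) ≤ q ^ (2 * r - k) := pow_le_pow_of_le_one hq0.le hq1.le (by omega)
    have h2 : q ^ (2 * r) = x ^ 2 := by rw [mul_comm, pow_mul]
    nlinarith [sq_nonneg (1 - x)]
  have hbase : 1 - x - x + q ^ (2 * r - k) ≤ (1 - x) ^ 2 * Real.exp δ := by
    calc 1 - x - x + q ^ (2 * r - k) ≤ (1 - x) ^ 2 + x * (k / r) := by linarith
      _ = (1 - x) ^ 2 * (δ + 1) := by rw [hδ]; field_simp; ring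
      _ ≤ (1 - x) ^ 2 * Real.exp δ := by gcongr; exact Real.add_one_le_exp δ
  calc (1 - x - x + q ^ (2 * r - k)) ^ N ≤ ((1 - x) ^ 2 * Real.exp δ) ^ N := by gcongr
    _ = (1 - x) ^ (2 * N) * Real.exp (N * δ) := by rw [mul_pow, ← pow_mul, Real.exp_nat_mul]
    -- Uses `2 * (n - r) ≤ 2 * N + 2 * r` and `N ≤ n`.
    _ ≤ (((1 - x) ^ (n - r)) ^ 2 * ((1 - x) ^ (2 * r))⁻¹) * Real.exp (n * δ) := by
        gcongr
        · rw [← div_eq_mul_inv, le_div_iff₀ (by positivity), ← pow_add, ← pow_mul]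
          exact pow_le_pow_of_le_one hy.le (by linarith) (by omega)
        · omega
    _ = _ := by
        rw [mul_assoc, ← Real.exp_nat_mul]
        congr 3
        rw [hδ]
        field_simp

/-- A quantitative lower bound for the probability of a tropical dominating set with exactly one
vertex of each of `r` colours. -/
lemma exists_tropical_lower_bound {p : unitInterval} (hp0 : (0 : ℝ) < p) (hp1 : (p : ℝ) < 1)
    (hr : 0 < r) (hm : 0 < m) (hmn : r * m ≤ n) (h2r : 2 * r ≤ n) :
    (1 - 2 * r * (1 - p : ℝ) ^ r) *
        Real.exp (-(r ^ 2 * Real.exp (n * (1 - p : ℝ) ^ r / ((1 - (1 - p : ℝ) ^ r) ^ 2 * r)) / m)) ≤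
      (colouredRandomGraph n p r).real
        {ω | ∃ S : Finset (Fin n), S.card = r ∧ IsTropicalDominating ω.1 ω.2 S} := by
  have : NeZero r := ⟨hr.ne'⟩
  have : NeZero m := ⟨hm.ne'⟩
  obtain ⟨e⟩ : Nonempty (Fin r × Fin m ↪ Fin n) :=
    Function.Embedding.nonempty_of_card_le (by simpa using hmn)
  have hprob : IsProbabilityMeasure (colouredRandomGraph n p r) := by
    unfold colouredRandomGraph
    infer_instance
  set q : ℝ := 1 - p with hq
  have hq0 : 0 < q := by linarith
  have hq1 : q < 1 := by linarith
  have hx0 : 0 < q ^ r := by positivity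
  have hx1 : q ^ r < 1 := pow_lt_one₀ hq0.le hq1 hr.ne'
  set w := Real.exp (n * q ^ r / ((1 - q ^ r) ^ 2 * r)) with hw
  -- The prescribed colour is the block index; the default `0` off the blocks is never consulted.
  set g : Fin n → Fin r := Function.extend e Prod.fst fun _ => 0 with hg
  have hge : ∀ x, g (e x) = x.1 := fun x => e.injective.extend_apply _ _ x
  set C : Finset (Fin n) → Set (Fin n → Fin r) := fun U => {col | ∀ v ∈ U, col v = g v} with hC
  set A : (Fin r → Fin m) → Set (SimpleGraph (Fin n) × (Fin n → Fin r)) := fun s =>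
    {G | IsDominating G (transversal e s)} ×ˢ C (transversal e s) with hA
  have hr' : (0 : ℝ) < r := by exact_mod_cast hr
  have hm' : (0 : ℝ) < m := by exact_mod_cast hm
  have hy : 0 < 1 - q ^ r := by linarith
  set a : ℝ := (1 - q ^ r) ^ (n - r) * (r : ℝ)⁻¹ ^ r with ha
  set ρ : (Fin r → Fin m) → (Fin r → Fin m) → ℝ := fun s t =>
    ((1 - q ^ r) ^ (2 * r))⁻¹ * ∏ i, (if s i = t i then r * w else 1) with hρ
  have hsub : ⋃ s, A s ⊆
      {ω | ∃ S : Finset (Fin n), S.card = r ∧ IsTropicalDominating ω.1 ω.2 S} := by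
    rintro ω hω
    obtain ⟨s, hs⟩ := Set.mem_iUnion.1 hω
    refine ⟨transversal e s, card_transversal e s, hs.1, fun i => ⟨e (i, s i), ?_, ?_⟩⟩
    · exact (mem_transversal e s).2 ⟨i, rfl⟩
    · rw [hs.2 _ ((mem_transversal e s).2 ⟨i, rfl⟩), hge]
  have h₁ : ∀ s, a ≤ (colouredRandomGraph n p r).real (A s) := by
    intro s
    rw [hA, colouredRandomGraph, measureReal_prod_prod, binomialRandom_real_isDominating,
      randomColouring_real_eqOn, card_transversal, Fintype.card_fin]
  have h₂ : ∀ s t, (colouredRandomGraph n p r).real (A s ∩ A t) ≤ a ^ 2 * ρ s t := by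
    intro s t
    set k := (Finset.univ.filter fun i => s i = t i).card with hk
    have hkr : k ≤ r := by
      simpa using Finset.card_le_univ (Finset.univ.filter fun i => s i = t i)
    have hCC : C (transversal e s) ∩ C (transversal e t) =
        C (transversal e s ∪ transversal e t) := by
      ext col
      simp only [hC, Set.mem_inter_iff, Set.mem_ofPred_eq, Finset.mem_union]
      grind
    have hdom := binomialRandom_real_isDominating_inter_le p (transversal e s) (transversal e t)
    rw [card_transversal_union, card_transversal, card_transversal, Fintype.card_fin, ← hk,
      ← hq] at hdom
    have hprod : ∏ i, (if s i = t i then r * w else 1) = (r * w) ^ k := by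
      rw [Finset.prod_ite, Finset.prod_const, Finset.prod_const_one, mul_one]
    -- Each of the `k` shared vertices is coloured once instead of twice, a gain of `r` per
    -- agreement.
    have hcol : (r : ℝ)⁻¹ ^ (2 * r - k) = ((r : ℝ)⁻¹ ^ r) ^ 2 * r ^ k := by
      rw [← pow_mul, mul_comm r 2]
      conv_rhs => rw [← Nat.sub_add_cancel (show k ≤ 2 * r by omega), pow_add]
      rw [mul_assoc, ← mul_pow, inv_mul_cancel₀ hr'.ne', one_pow, mul_one]
    rw [hA, Set.prod_inter_prod, colouredRandomGraph, measureReal_prod_prod, hCC,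
      randomColouring_real_eqOn, card_transversal_union, ← hk, hcol]
    calc _ ≤ _ := mul_le_mul_of_nonneg_right
            (hdom.trans (both_dominate_bound hq0 hq1 hr hkr (by omega))) (by positivity)
      _ = a ^ 2 * ρ s t := by simp only [ha, hρ]; rw [hprod, ← hw]; ring
  have hmain := card_sq_div_sum_le_measureReal_iUnion (colouredRandomGraph n p r)
    (fun s => (Set.toFinite (A s)).measurableSet) (show 0 < a by positivity) h₁ h₂
  refine le_trans ?_ (hmain.trans (measureReal_mono hsub))
  simp_rw [hρ, ← Finset.mul_sum]
  rw [sum_sum_prod_ite_eq, Fintype.card_fun, Fintype.card_fin, Fintype.card_fin]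
  have hw0 : 0 < w := Real.exp_pos _
  have hm1 : (1 : ℝ) ≤ m := by exact_mod_cast hm
  have hden : 0 < (m : ℝ) - 1 + r * w := by
    have : 0 < r * w := by positivity
    linarith
  have heq : (((m ^ r : ℕ) : ℝ)) ^ 2 /
      (((1 - q ^ r) ^ (2 * r))⁻¹ * ((m : ℝ) ^ r * ((m : ℝ) - 1 + r * w) ^ r)) =
      (1 - q ^ r) ^ (2 * r) * (m / ((m : ℝ) - 1 + r * w)) ^ r := by
    push_cast
    rw [div_pow]
    field_simp
  rw [heq]
  -- Bernoulli's inequality.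
  have hb : 1 - 2 * r * q ^ r ≤ (1 - q ^ r) ^ (2 * r) := by
    have := one_add_mul_le_pow (a := -q ^ r) (by linarith) (2 * r)
    push_cast at this
    calc _ = _ := by ring
      _ ≤ _ := this
      _ = _ := by ring
  have hexp : Real.exp (-(r ^ 2 * w / m)) ≤ (m / ((m : ℝ) - 1 + r * w)) ^ r := by
    have h1 : Real.exp (-(r ^ 2 * w / m)) = Real.exp (-(r * w / m)) ^ r := by
      rw [← Real.exp_nat_mul]; congr 1; ring
    rw [h1]
    gcongr
    rw [Real.exp_neg, inv_le_comm₀ (Real.exp_pos _) (by positivity), inv_div]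
    calc ((m : ℝ) - 1 + r * w) / m ≤ r * w / m + 1 := by
          rw [div_add_one hm'.ne']
          exact div_le_div_of_nonneg_right (by linarith) hm'.le
      _ ≤ _ := Real.add_one_le_exp _
  gcongr

/-! ### Asymptotics of the number of colours -/

lemma tendsto_logb_natCast_atTop {b : ℝ} (hb : 1 < b) :
    Tendsto (fun n : ℕ => Real.logb b n) atTop atTop :=
  (Real.tendsto_logb_atTop hb).comp tendsto_natCast_atTop_atTop

lemma tendsto_log_pow_mul_rpow_neg (k : ℕ) {s : ℝ} (hs : 0 < s) :
    Tendsto (fun n : ℕ => Real.log n ^ k * (n : ℝ) ^ (-s)) atTop (𝓝 0) := by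
  have h := (isLittleO_log_rpow_rpow_atTop (k : ℝ) hs).tendsto_div_nhds_zero.comp
    tendsto_natCast_atTop_atTop
  refine h.congr fun n => ?_
  simp only [Function.comp_apply]
  rw [Real.rpow_natCast, Real.rpow_neg (Nat.cast_nonneg n), div_eq_mul_inv]

lemma tendsto_logb_logb_mul_log_div {b : ℝ} (hb : 1 < b) :
    Tendsto (fun n : ℕ => Real.logb b (Real.logb b n * Real.log n) / Real.logb b n) atTop (𝓝 0) := by
  have hlb : 0 < Real.log b := Real.log_pos hb
  have hL := tendsto_logb_natCast_atTop hb
  have h1 : Tendsto (fun n : ℕ => Real.log (Real.logb b n) / Real.logb b n) atTop (𝓝 0) :=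
    Real.isLittleO_log_id_atTop.tendsto_div_nhds_zero.comp hL
  have h2 : Tendsto (fun n : ℕ => Real.logb b (Real.log b) / Real.logb b n) atTop (𝓝 0) :=
    tendsto_const_nhds.div_atTop hL
  have h3 : Tendsto (fun n : ℕ => 2 / Real.log b * (Real.log (Real.logb b n) / Real.logb b n) +
      Real.logb b (Real.log b) / Real.logb b n) atTop (𝓝 0) := by
    simpa using (h1.const_mul (2 / Real.log b)).add h2
  refine h3.congr' ?_
  filter_upwards [hL.eventually_gt_atTop 0] with n hn
  have hlog : Real.log n = Real.logb b n * Real.log b := by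
    rw [Real.logb]; field_simp
  have hne := hn.ne'
  have hmul : Real.logb b (Real.logb b n * Real.log n) =
      2 * Real.logb b (Real.logb b n) + Real.logb b (Real.log b) := by
    rw [hlog, Real.logb_mul hne (mul_ne_zero hne hlb.ne'), Real.logb_mul hne hlb.ne']
    ring
  have hdef : Real.logb b (Real.logb b n) = Real.log (Real.logb b n) / Real.log b := rfl
  rw [hmul, hdef]
  ring

lemma tendsto_logb_mul_log_atTop {b : ℝ} (hb : 1 < b) :
    Tendsto (fun n : ℕ => Real.logb b n * Real.log n) atTop atTop :=
  (tendsto_logb_natCast_atTop hb).atTop_mul_atTop₀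
    (Real.tendsto_log_atTop.comp tendsto_natCast_atTop_atTop)

lemma tendsto_threshold_div {b : ℝ} (hb : 1 < b) :
    Tendsto (fun n : ℕ => (Real.logb b n - Real.logb b (Real.logb b n * Real.log n)) /
      Real.logb b n) atTop (𝓝 1) := by
  have h : Tendsto (fun n : ℕ => 1 - Real.logb b (Real.logb b n * Real.log n) / Real.logb b n)
      atTop (𝓝 1) := by
    simpa using (tendsto_logb_logb_mul_log_div hb).const_sub 1
  refine h.congr' ?_
  filter_upwards [(tendsto_logb_natCast_atTop hb).eventually_gt_atTop 0] with n hn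
  rw [sub_div, div_self hn.ne']

/-- For large `n` no truncation takes place in `numColours`. -/
lemma eventually_numColours_bounds {b : ℝ} (hb : 1 < b) :
    ∀ᶠ n : ℕ in atTop,
      Real.logb b n - Real.logb b (Real.logb b n * Real.log n) + 1 < numColours b n ∧
      (numColours b n : ℝ) ≤ Real.logb b n - Real.logb b (Real.logb b n * Real.log n) + 2 ∧
      0 < numColours b n := by
  filter_upwards [(tendsto_threshold_div hb).eventually_const_lt one_pos,
    (tendsto_logb_natCast_atTop hb).eventually_gt_atTop 0] with n h1 h2
  set y := Real.logb b n - Real.logb b (Real.logb b n * Real.log n) with hy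
  have hy0 : 0 < y := (div_pos_iff_of_pos_right h2).1 h1
  have hfl : 0 ≤ ⌊y⌋ := Int.floor_nonneg.2 hy0.le
  have hcast : (numColours b n : ℤ) = ⌊y⌋ + 2 := by
    rw [numColours, ← hy, Int.toNat_of_nonneg (by omega)]
  have hcast' : (numColours b n : ℝ) = (⌊y⌋ : ℝ) + 2 := by exact_mod_cast hcast
  refine ⟨?_, ?_, by omega⟩
  · rw [hcast']
    linarith [Int.lt_floor_add_one y]
  · rw [hcast']
    linarith [Int.floor_le y]

lemma tendsto_numColours_div {b : ℝ} (hb : 1 < b) :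
    Tendsto (fun n : ℕ => (numColours b n : ℝ) / Real.logb b n) atTop (𝓝 1) := by
  have hL := tendsto_logb_natCast_atTop hb
  have hk : ∀ k : ℝ, Tendsto (fun n : ℕ =>
      (Real.logb b n - Real.logb b (Real.logb b n * Real.log n) + k) / Real.logb b n)
      atTop (𝓝 1) := by
    intro k
    simpa [add_div] using (tendsto_threshold_div hb).add
      ((tendsto_const_nhds (x := k)).div_atTop hL)
  refine tendsto_of_tendsto_of_tendsto_of_le_of_le' (hk 1) (hk 2) ?_ ?_ <;>
  · filter_upwards [eventually_numColours_bounds hb, hL.eventually_gt_atTop 0] with n h1 h2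
    exact div_le_div_of_nonneg_right (by linarith [h1.1, h1.2.1]) h2.le

lemma eventually_numColours_le_logb {b : ℝ} (hb : 1 < b) :
    ∀ᶠ n : ℕ in atTop, (numColours b n : ℝ) ≤ Real.logb b n := by
  filter_upwards [eventually_numColours_bounds hb,
    ((Real.tendsto_logb_atTop hb).comp (tendsto_logb_mul_log_atTop hb)).eventually_ge_atTop 2]
    with n h1 h2
  simp only [Function.comp_apply] at h2
  linarith [h1.2.1]

/-- A given vertex has no neighbour in a given set of `numColours b n` vertices with probability
at most `b⁻¹ (log_b n) (log n) / n`. -/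
lemma eventually_inv_pow_numColours_le {b : ℝ} (hb : 1 < b) :
    ∀ᶠ n : ℕ in atTop,
      b⁻¹ ^ numColours b n ≤ b⁻¹ * (Real.logb b n * Real.log n) / n := by
  filter_upwards [eventually_numColours_bounds hb, eventually_gt_atTop 0,
    (tendsto_logb_mul_log_atTop hb).eventually_gt_atTop 0] with n h1 h2 h3
  have hb0 : 0 < b := by linarith
  have hn : (0 : ℝ) < n := by exact_mod_cast h2
  -- The `+ 2` in `numColours` leaves `+ 1` after the floor. This is the source of the factor `b⁻¹ <
  -- 1`, without which the exponent `θ` could not be taken below `1`.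
  have h4 : b ^ (Real.logb b n - Real.logb b (Real.logb b n * Real.log n) + 1) ≤
      b ^ numColours b n := by
    rw [← Real.rpow_natCast]
    exact Real.rpow_le_rpow_of_exponent_le hb.le h1.1.le
  rw [Real.rpow_add hb0, Real.rpow_sub hb0, Real.rpow_logb hb0 hb.ne' hn,
    Real.rpow_logb hb0 hb.ne' h3, Real.rpow_one] at h4
  rw [inv_pow]
  refine (inv_anti₀ (by positivity) h4).trans (le_of_eq ?_)
  field_simp

lemma tendsto_logb_pow_mul_logb_mul_log_div (k : ℕ) (b : ℝ) :
    Tendsto (fun n : ℕ => Real.logb b n ^ k * (Real.logb b n * Real.log n) / n)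
      atTop (𝓝 0) := by
  have h := (tendsto_log_pow_mul_rpow_neg (k + 2) one_pos).const_mul ((Real.log b)⁻¹ ^ (k + 1))
  rw [mul_zero] at h
  refine h.congr fun n => ?_
  rw [Real.logb, Real.rpow_neg_one]
  ring

lemma tendsto_numColours_pow_mul_inv_pow {b : ℝ} (hb : 1 < b) (k : ℕ) :
    Tendsto (fun n : ℕ => (numColours b n : ℝ) ^ k * b⁻¹ ^ numColours b n) atTop (𝓝 0) := by
  have hb0 : 0 < b := by linarith
  have h := (tendsto_logb_pow_mul_logb_mul_log_div k b).const_mul b⁻¹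
  rw [mul_zero] at h
  refine tendsto_of_tendsto_of_tendsto_of_le_of_le' tendsto_const_nhds h
    (.of_forall fun n => by positivity) ?_
  filter_upwards [eventually_numColours_le_logb hb, eventually_inv_pow_numColours_le hb]
    with n h1 h2
  have h3 : 0 ≤ Real.logb b n := (Nat.cast_nonneg _).trans h1
  calc (numColours b n : ℝ) ^ k * b⁻¹ ^ numColours b n
      ≤ Real.logb b n ^ k * (b⁻¹ * (Real.logb b n * Real.log n) / n) := by gcongr
    _ = _ := by ring

/-- The correlation factor is at most a power of `n` with exponent less than `1`. -/
lemma eventually_exp_correlation_le {b : ℝ} (hb : 1 < b) {θ : ℝ} (hθ : b⁻¹ < θ) :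
    ∀ᶠ n : ℕ in atTop,
      Real.exp (n * b⁻¹ ^ numColours b n /
        ((1 - b⁻¹ ^ numColours b n) ^ 2 * numColours b n)) ≤ (n : ℝ) ^ θ := by
  have hb0 : 0 < b := by linarith
  have hθ0 : 0 < θ := (inv_pos.2 hb0).trans hθ
  have hx : Tendsto (fun n : ℕ => b⁻¹ ^ numColours b n) atTop (𝓝 0) := by
    simpa using tendsto_numColours_pow_mul_inv_pow hb 0
  have h : Tendsto (fun n : ℕ => (1 - b⁻¹ ^ numColours b n) ^ 2 *
      ((numColours b n : ℝ) / Real.logb b n)) atTop (𝓝 1) := by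
    simpa using ((hx.const_sub 1).pow 2).mul (tendsto_numColours_div hb)
  -- Since `b⁻¹ / θ < 1`, the slack in `θ` absorbs both `(1 - x) ^ 2` and the ratio of `numColours b
  -- n` to `log_b n`.
  filter_upwards [h.eventually_const_lt ((div_lt_one hθ0).2 hθ),
    eventually_inv_pow_numColours_le hb, (tendsto_logb_natCast_atTop hb).eventually_gt_atTop 0,
    eventually_gt_atTop 1] with n h1 h2 h3 h4
  have hn : (0 : ℝ) < n := by positivity
  have hlog : 0 < Real.log n := Real.log_pos (by exact_mod_cast h4)
  set x := b⁻¹ ^ numColours b n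
  have h5 : b⁻¹ * Real.logb b n < θ * ((1 - x) ^ 2 * numColours b n) := by
    rw [← mul_div_assoc, div_lt_div_iff₀ hθ0 h3] at h1
    linarith
  have h6 : 0 < (1 - x) ^ 2 * numColours b n := by
    have : 0 < b⁻¹ * Real.logb b n := by positivity
    exact (mul_pos_iff_of_pos_left hθ0).1 (this.trans h5)
  rw [Real.rpow_def_of_pos hn, Real.exp_le_exp, div_le_iff₀ h6]
  calc n * x ≤ n * (b⁻¹ * (Real.logb b n * Real.log n) / n) := by gcongr
    _ = Real.log n * (b⁻¹ * Real.logb b n) := by field_simp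
    _ ≤ Real.log n * (θ * ((1 - x) ^ 2 * numColours b n)) := by gcongr
    _ = _ := by ring

lemma eventually_two_mul_numColours_le {b : ℝ} (hb : 1 < b) :
    ∀ᶠ n : ℕ in atTop, 2 * numColours b n ≤ n := by
  have h : Tendsto (fun n : ℕ => 2 * (Real.log b)⁻¹ * (Real.log n ^ 1 * (n : ℝ) ^ (-1 : ℝ)))
      atTop (𝓝 0) := by
    simpa using (tendsto_log_pow_mul_rpow_neg 1 one_pos).const_mul (2 * (Real.log b)⁻¹)
  filter_upwards [eventually_numColours_le_logb hb, h.eventually_lt_const one_pos,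
    eventually_gt_atTop 0] with n h1 h2 h3
  have hn : (0 : ℝ) < n := by exact_mod_cast h3
  rw [pow_one, Real.rpow_neg_one, ← mul_assoc, ← div_eq_mul_inv, div_lt_one hn] at h2
  have h4 : 2 * (numColours b n : ℝ) ≤ n := by
    refine le_trans (mul_le_mul_of_nonneg_left h1 zero_le_two) (le_of_eq_of_le ?_ h2.le)
    rw [Real.logb]
    ring
  exact_mod_cast h4

/-- The exponent of the second moment bound vanishes in the limit. -/
lemma tendsto_numColours_sq_mul_exp_div {b : ℝ} (hb : 1 < b) :
    Tendsto (fun n : ℕ => (numColours b n : ℝ) ^ 2 * Real.exp (n * b⁻¹ ^ numColours b n /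
        ((1 - b⁻¹ ^ numColours b n) ^ 2 * numColours b n)) / ((n / numColours b n : ℕ) : ℝ))
      atTop (𝓝 0) := by
  have hb1 : b⁻¹ < 1 := inv_lt_one_of_one_lt₀ hb
  obtain ⟨θ, hθ, hθ1⟩ := exists_between hb1
  have h := (tendsto_log_pow_mul_rpow_neg 3 (sub_pos.2 hθ1)).const_mul (2 * (Real.log b)⁻¹ ^ 3)
  rw [mul_zero] at h
  refine tendsto_of_tendsto_of_tendsto_of_le_of_le' tendsto_const_nhds h
    (.of_forall fun n => by positivity) ?_
  filter_upwards [eventually_numColours_le_logb hb, eventually_exp_correlation_le hb hθ,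
    eventually_two_mul_numColours_le hb, eventually_numColours_bounds hb,
    eventually_gt_atTop 0] with n h1 h2 h3 h4 h5
  have hn : (0 : ℝ) < n := by exact_mod_cast h5
  set r := numColours b n
  have hr : 0 < r := h4.2.2
  have hr' : (0 : ℝ) < r := by exact_mod_cast hr
  -- Rounding down loses less than `r ≤ n / 2` from `(n / r) * r`.
  have hm : (n : ℝ) / (2 * r) ≤ ((n / r : ℕ) : ℝ) := by
    rw [div_le_iff₀ (by positivity)]
    have h6 : n ≤ (n / r) * (2 * r) := by
      have := Nat.lt_div_mul_add hr (a := n)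
      nlinarith
    exact_mod_cast h6
  calc _ ≤ (r : ℝ) ^ 2 * (n : ℝ) ^ θ / (n / (2 * r)) := by gcongr
    _ = 2 * (r : ℝ) ^ 3 * ((n : ℝ) ^ θ / n) := by field_simp
    _ ≤ 2 * Real.logb b n ^ 3 * ((n : ℝ) ^ θ / n) := by gcongr
    _ = _ := by
        rw [Real.logb, neg_sub, Real.rpow_sub hn, Real.rpow_one]
        ring

end TropicalDomination

/-! ### Conclusion: squeezing the probability between the finite bound and `1` -/

theorem mainTheorem3 (p : ℝ) (hp0 : 0 < p) (hp1 : p < 1) (b : ℝ) (hb : b = 1 / (1 - p))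
    (c : ℕ → ℕ) (hc : ∀ n, c n = TropicalDomination.numColours b n) :
    Tendsto
      (fun n : ℕ =>
        TropicalDomination.colouredRandomGraph n ⟨p, hp0.le, hp1.le⟩ (c n)
          {ω | ∃ S : Finset (Fin n),
            S.card = c n ∧ TropicalDomination.IsTropicalDominating ω.1 ω.2 S})
      atTop (𝓝 1) := by
  obtain rfl : c = TropicalDomination.numColours b := funext hc
  have hq : 1 - p = b⁻¹ := by rw [hb, one_div, inv_inv]
  have hb1 : 1 < b := by
    rw [hb, lt_div_iff₀ (by linarith)]
    linarith
  have hlim : Tendsto (fun n : ℕ =>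
      (1 - 2 * TropicalDomination.numColours b n * b⁻¹ ^ TropicalDomination.numColours b n) *
        Real.exp (-(TropicalDomination.numColours b n ^ 2 *
          Real.exp (n * b⁻¹ ^ TropicalDomination.numColours b n /
            ((1 - b⁻¹ ^ TropicalDomination.numColours b n) ^ 2 *
              TropicalDomination.numColours b n)) /
          ((n / TropicalDomination.numColours b n : ℕ) : ℝ)))) atTop (𝓝 1) := by
    have h1 := ((TropicalDomination.tendsto_numColours_pow_mul_inv_pow hb1 1).const_mul 2).const_sub
      1
    have h2 := (Real.continuous_exp.tendsto _).comp
      (TropicalDomination.tendsto_numColours_sq_mul_exp_div hb1).neg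
    have h3 := h1.mul h2
    simpa [Function.comp_def, mul_assoc] using h3
  have hlim' := (ENNReal.continuous_ofReal.tendsto _).comp hlim
  rw [ENNReal.ofReal_one] at hlim'
  have hgood := (TropicalDomination.eventually_numColours_bounds hb1).and
    (TropicalDomination.eventually_two_mul_numColours_le hb1)
  refine tendsto_of_tendsto_of_tendsto_of_le_of_le' hlim' tendsto_const_nhds ?_ ?_
  all_goals
    filter_upwards [hgood] with n hn
    have : NeZero (TropicalDomination.numColours b n) := ⟨hn.1.2.2.ne'⟩
    have : IsProbabilityMeasure (TropicalDomination.colouredRandomGraph n ⟨p, hp0.le, hp1.le⟩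
        (TropicalDomination.numColours b n)) := by
      unfold TropicalDomination.colouredRandomGraph
      infer_instance
  · have h := TropicalDomination.exists_tropical_lower_bound (n := n)
      (m := n / TropicalDomination.numColours b n) (p := ⟨p, hp0.le, hp1.le⟩) hp0 hp1 hn.1.2.2
      (Nat.div_pos (by omega) hn.1.2.2) (Nat.mul_div_le _ _) hn.2
    simp only [hq] at h
    exact ENNReal.ofReal_le_of_le_toReal h
  · exact prob_le_one
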